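/- Conventions. Let HTop be the homotopy category of topological spaces and HPol its full subcategory of spaces having the homotopy type of a polyhedron (the realization $|K|$ of a simplicial complex with the weak topology). An inverse system $\mathbf X=(X_\lambda,p_{\lambda\lambda'},\Lambda)$ in HTop is indexed by a nonempty directed preordered set. The objects of pro-HTop and of pro$^*$-HTop are all such inverse systems. A morphism $\mathbf X\to\mathbf Y=(Y_\mu,q_{\mu\mu'},M)$ of pro$^*$-HTop is an equivalence class of $S^*$-morphisms $(f,f^n_\mu)$: a function $f:M\to\Lambda$ and maps $f^n_\mu:X_{f(\mu)}\to Y_\mu$ $(n\in\mathbb N,\ \mu\in M)$ such that for all $\mu\le\mu'$ there are $\lambda\ge f(\mu),f(\mu')$ and $n$ with $q_{\mu\mu'}f^{n'}_{\mu'}p_{f(\mu')\lambda}\simeq f^{n'}_\mu p_{f(\mu)\lambda}$ for all $n'\ge n$; here $(f,f^n_\mu)\sim(g,g^n_\mu)$ if every $\mu$ admits $\lambda\ge f(\mu),g(\mu)$ and $n$ with $f^{n'}_\mu p_{f(\mu)\lambda}\simeq g^{n'}_\mu p_{g(\mu)\lambda}$ for all $n'\ge n$. Composition is $(g,g^n_\nu)(f,f^n_\mu)=(fg,\,g^n_\nu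 f^n_{g(\nu)})$. The category pro-HTop is defined in the same way with maps $f_\mu$ that do not depend on $n$, and $J:\text{pro-HTop}\to\text{pro}^*\text{-HTop}$ is the functor with $J[(f,f_\mu)]=[(f,f^n_\mu)]$, $f^n_\mu=f_\mu$. A space $X$ is regarded as a system indexed by one point. An HPol-expansion (resp. HPol$^*$-expansion) of a space $X$ is a morphism $X\to\mathbf X$ of pro-HTop (resp. pro$^*$-HTop) with $\mathbf X$ an inverse system in HPol, such that every morphism $X\to\mathbf Y$ of pro-HTop (resp. pro$^*$-HTop) with $\mathbf Y$ an inverse system in HPol factors uniquely through it. The coarse shape category Sh$^*$ has all topological spaces as objects. A morphism $X\to Y$ is an equivalence class $\langle\mathbf f^*\rangle$ of morphisms $\mathbf f^*:\mathbf X\to\mathbf Y$ of pro$^*$-HTop, where $X\to\mathbf X$ and $Y\to\mathbf Y$ are any HPol-expansions; $\mathbf f^*:\mathbf X\to\mathbf Y$ and $\mathbf f'^*:\mathbf X'\to\mathbf Y'$ are equivalent if $\mathbf f'^*J(\mathbf i)=J(\mathbf j)\mathbf f^*$ for the canonical isomorphisms $\mathbf i:\mathbf X\to\mathbf X'$, $\mathbf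 j:\mathbf Y\to\mathbf Y'$ of pro-HTop between the expansions. Composition is by representatives. A map $f:X\to Y$ induces the coarse shape morphism $\mathcal S^*(f)=\langle J(\mathbf f)\rangle$, where $\mathbf p:X\to\mathbf X$, $\mathbf q:Y\to\mathbf Y$ are HPol-expansions and $\mathbf f:\mathbf X\to\mathbf Y$ is the unique morphism of pro-HTop with $\mathbf f\mathbf p=\mathbf q f$. Theorem. Let $X$ and $Y$ be topological spaces that admit HPol$^*$-expansions $\mathbf p^*=[(p^n_\lambda)]:X\to\mathbf X=(X_\lambda,p_{\lambda\lambda'},\Lambda)$ and $\mathbf q^*=[(q^n_\mu)]:Y\to\mathbf Y=(Y_\mu,q_{\mu\mu'},M)$ such that $$\mathbf p^*\times\mathbf q^*=[(p^n_\lambda\times q^n_\mu)]:X\times Y\to\mathbf X\times\mathbf Y=(X_\lambda\times Y_\mu,\;p_{\lambda\lambda'}\times q_{\mu\mu'},\;\Lambda\times M)$$ is an HPol$^*$-expansion of $X\times Y$. Then $X\times Y$, with the coarse shape morphisms $\mathcal S^*(\pi_X)$ and $\mathcal S^*(\pi_Y)$ of the projections, is a product of $X$ and $Y$ in Sh$^*$: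 for every topological space $Z$ and all coarse shape morphisms $F^*:Z\to X$ and $G^*:Z\to Y$ there is exactly one coarse shape morphism $H^*:Z\to X\times Y$ with $\mathcal S^*(\pi_X)H^*=F^*$ and $\mathcal S^*(\pi_Y)H^*=G^*$. -/

import Mathlib

open CategoryTheory

universe u v w

/-! ## Inverse systems, `pro-C` and `pro*-C` -/

/-- An inverse system `(X_λ, p_{λλ'}, Λ)` in a category `C`, indexed by a (nonempty) directed
preordered set `Λ`. -/
structure InvSystem (C : Type v) [Category.{w} C] where
  Idx : Type u
  [preorder : Preorder Idx]
  [nonempty : Nonempty Idx]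
  [directed : IsDirectedOrder Idx]
  obj : Idx → C
  bond : ∀ {i j : Idx}, i ≤ j → (obj j ⟶ obj i)
  bond_refl : ∀ i : Idx, bond (le_refl i) = 𝟙 (obj i)
  bond_trans : ∀ {i j k : Idx} (hij : i ≤ j) (hjk : j ≤ k),
    bond hjk ≫ bond hij = bond (hij.trans hjk)

attribute [instance] InvSystem.preorder InvSystem.nonempty InvSystem.directed

namespace InvSystem

variable {C : Type v} [Category.{w} C]

/-- The rudimentary system `(A)`, indexed by a one-point set. -/
def rud (A : C) : InvSystem.{u} C where
  Idx := PUnit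
  obj _ := A
  bond _ := 𝟙 A
  bond_refl _ := rfl
  bond_trans _ _ := Category.comp_id _

lemma exists_ge₃ (X : InvSystem.{u} C) (a b c : X.Idx) : ∃ l, a ≤ l ∧ b ≤ l ∧ c ≤ l := by
  obtain ⟨d, had, hbd⟩ := exists_ge_ge a b
  obtain ⟨e, hde, hce⟩ := exists_ge_ge d c
  exact ⟨e, had.trans hde, hbd.trans hde, hce⟩

/-- Equality of two morphisms out of terms of a system, after composing with bonding morphisms,
persists further up the system. -/
lemma bond_lift {X : InvSystem.{u} C} {A : C} {a b l k : X.Idx} {f : X.obj a ⟶ A} {g : X.obj b ⟶ A}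
    (ha : a ≤ l) (hb : b ≤ l) (h : X.bond ha ≫ f = X.bond hb ≫ g) (hk : l ≤ k) :
    X.bond (ha.trans hk) ≫ f = X.bond (hb.trans hk) ≫ g := by
  rw [← X.bond_trans ha hk, ← X.bond_trans hb hk, Category.assoc, Category.assoc, h]

/-! ### Morphisms of inverse systems -/

/-- A morphism `(f, f_μ)` of inverse systems. -/
structure Mor (X Y : InvSystem.{u} C) where
  idx : Y.Idx → X.Idx
  app : ∀ m, X.obj (idx m) ⟶ Y.obj m
  comm : ∀ {m m' : Y.Idx} (hm : m ≤ m'), ∃ (l : X.Idx) (h : idx m ≤ l) (h' : idx m' ≤ l),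
    X.bond h' ≫ app m' ≫ Y.bond hm = X.bond h ≫ app m

/-- An `S*`-morphism `(f, f^n_μ)` of inverse systems. -/
structure SMor (X Y : InvSystem.{u} C) where
  idx : Y.Idx → X.Idx
  app : ℕ → ∀ m, X.obj (idx m) ⟶ Y.obj m
  comm : ∀ {m m' : Y.Idx} (hm : m ≤ m'), ∃ (l : X.Idx) (h : idx m ≤ l) (h' : idx m' ≤ l),
    ∃ n : ℕ, ∀ n' ≥ n, X.bond h' ≫ app n' m' ≫ Y.bond hm = X.bond h ≫ app n' m

namespace Mor

variable {X Y Z : InvSystem.{u} C}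

/-- Equivalence of morphisms of inverse systems. -/
def Equiv (f g : Mor X Y) : Prop :=
  ∀ m : Y.Idx, ∃ (l : X.Idx) (h : f.idx m ≤ l) (h' : g.idx m ≤ l),
    X.bond h ≫ f.app m = X.bond h' ≫ g.app m

lemma Equiv.refl (f : Mor X Y) : f.Equiv f := fun m => ⟨f.idx m, le_rfl, le_rfl, rfl⟩

lemma Equiv.symm {f g : Mor X Y} (h : f.Equiv g) : g.Equiv f := fun m => by
  obtain ⟨l, a, b, e⟩ := h m
  exact ⟨l, b, a, e.symm⟩

lemma Equiv.trans {f g k : Mor X Y} (h : f.Equiv g) (h' : g.Equiv k) : f.Equiv k := fun m => by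
  obtain ⟨l, a, b, e⟩ := h m
  obtain ⟨l', a', b', e'⟩ := h' m
  obtain ⟨t, ht, ht'⟩ := exists_ge_ge l l'
  exact ⟨t, a.trans ht, b'.trans ht', (bond_lift a b e ht).trans (bond_lift a' b' e' ht')⟩

instance setoid (X Y : InvSystem.{u} C) : Setoid (Mor X Y) :=
  ⟨Equiv, Equiv.refl, Equiv.symm, Equiv.trans⟩

/-- The identity morphism of an inverse system. -/
def id (X : InvSystem.{u} C) : Mor X X where
  idx l := l
  app l := 𝟙 _
  comm {m m'} hm := ⟨m', hm, le_rfl, by simp [X.bond_refl]⟩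

/-- Composition of morphisms of inverse systems. -/
def comp (f : Mor X Y) (g : Mor Y Z) : Mor X Z where
  idx n := f.idx (g.idx n)
  app n := f.app (g.idx n) ≫ g.app n
  comm {n n'} hn := by
    obtain ⟨m, h, h', e⟩ := g.comm hn
    obtain ⟨l₁, a₁, b₁, e₁⟩ := f.comm h
    obtain ⟨l₂, a₂, b₂, e₂⟩ := f.comm h'
    obtain ⟨l, hl₁, hl₂⟩ := exists_ge_ge l₁ l₂
    refine ⟨l, a₁.trans hl₁, a₂.trans hl₂, ?_⟩
    have e₁' := bond_lift b₁ a₁ (f := f.app m ≫ Y.bond h) e₁ hl₁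
    have e₂' := bond_lift b₂ a₂ (f := f.app m ≫ Y.bond h') e₂ hl₂
    simp only [Category.assoc]
    rw [← reassoc_of% e₁', ← reassoc_of% e₂', e]

lemma comp_equiv {f f' : Mor X Y} {g g' : Mor Y Z} (hf : f.Equiv f') (hg : g.Equiv g') :
    (f.comp g).Equiv (f'.comp g') := fun n => by
  obtain ⟨m, h, h', e⟩ := hg n
  obtain ⟨l₁, a₁, b₁, e₁⟩ := f.comm h
  obtain ⟨l₂, a₂, b₂, e₂⟩ := f.comm h'
  obtain ⟨l₃, a₃, b₃, e₃⟩ := hf (g'.idx n)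
  obtain ⟨l, hl₁, hl₂, hl₃⟩ := X.exists_ge₃ l₁ l₂ l₃
  refine ⟨l, a₁.trans hl₁, b₃.trans hl₃, ?_⟩
  have e₁' := bond_lift b₁ a₁ (f := f.app m ≫ Y.bond h) e₁ hl₁
  have e₂' := bond_lift b₂ a₂ (f := f.app m ≫ Y.bond h') e₂ hl₂
  have e₃' := bond_lift a₃ b₃ e₃ hl₃
  change X.bond _ ≫ f.app _ ≫ g.app _ = X.bond _ ≫ f'.app _ ≫ g'.app _
  rw [← reassoc_of% e₁', e, ← reassoc_of% e₃', ← reassoc_of% e₂']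

end Mor

namespace SMor

variable {X Y Z : InvSystem.{u} C}

/-- Equivalence of `S*`-morphisms. -/
def Equiv (f g : SMor X Y) : Prop :=
  ∀ m : Y.Idx, ∃ (l : X.Idx) (h : f.idx m ≤ l) (h' : g.idx m ≤ l),
    ∃ n : ℕ, ∀ n' ≥ n, X.bond h ≫ f.app n' m = X.bond h' ≫ g.app n' m

lemma Equiv.refl (f : SMor X Y) : f.Equiv f :=
  fun m => ⟨f.idx m, le_rfl, le_rfl, 0, fun _ _ => rfl⟩

lemma Equiv.symm {f g : SMor X Y} (h : f.Equiv g) : g.Equiv f := fun m => by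
  obtain ⟨l, a, b, n, e⟩ := h m
  exact ⟨l, b, a, n, fun n' hn' => (e n' hn').symm⟩

lemma Equiv.trans {f g k : SMor X Y} (h : f.Equiv g) (h' : g.Equiv k) : f.Equiv k := fun m => by
  obtain ⟨l, a, b, n, e⟩ := h m
  obtain ⟨l', a', b', n', e'⟩ := h' m
  obtain ⟨t, ht, ht'⟩ := exists_ge_ge l l'
  exact ⟨t, a.trans ht, b'.trans ht', max n n', fun i hi =>
    (bond_lift a b (e i ((le_max_left _ _).trans hi)) ht).trans
      (bond_lift a' b' (e' i ((le_max_right _ _).trans hi)) ht')⟩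

instance setoid (X Y : InvSystem.{u} C) : Setoid (SMor X Y) :=
  ⟨Equiv, Equiv.refl, Equiv.symm, Equiv.trans⟩

/-- The `S*`-morphism with `f^n_μ = f_μ` for all `n`. -/
def ofMor (f : Mor X Y) : SMor X Y where
  idx := f.idx
  app _ m := f.app m
  comm hm := by
    obtain ⟨l, a, b, e⟩ := f.comm hm
    exact ⟨l, a, b, 0, fun _ _ => e⟩

/-- The identity `S*`-morphism of an inverse system. -/
def id (X : InvSystem.{u} C) : SMor X X where
  idx l := l
  app _ l := 𝟙 _
  comm {m m'} hm := ⟨m', hm, le_rfl, 0, fun _ _ => by simp [X.bond_refl]⟩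

/-- Composition of `S*`-morphisms. -/
def comp (f : SMor X Y) (g : SMor Y Z) : SMor X Z where
  idx n := f.idx (g.idx n)
  app i n := f.app i (g.idx n) ≫ g.app i n
  comm {n n'} hn := by
    obtain ⟨m, h, h', k, e⟩ := g.comm hn
    obtain ⟨l₁, a₁, b₁, k₁, e₁⟩ := f.comm h
    obtain ⟨l₂, a₂, b₂, k₂, e₂⟩ := f.comm h'
    obtain ⟨l, hl₁, hl₂⟩ := exists_ge_ge l₁ l₂
    refine ⟨l, a₁.trans hl₁, a₂.trans hl₂, max k (max k₁ k₂), fun i hi => ?_⟩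
    simp only [ge_iff_le, max_le_iff] at hi
    have e₁' := bond_lift b₁ a₁ (f := f.app i m ≫ Y.bond h) (e₁ i hi.2.1) hl₁
    have e₂' := bond_lift b₂ a₂ (f := f.app i m ≫ Y.bond h') (e₂ i hi.2.2) hl₂
    simp only [Category.assoc]
    rw [← reassoc_of% e₁', ← reassoc_of% e₂', e i hi.1]

lemma comp_equiv {f f' : SMor X Y} {g g' : SMor Y Z} (hf : f.Equiv f') (hg : g.Equiv g') :
    (f.comp g).Equiv (f'.comp g') := fun n => by
  obtain ⟨m, h, h', k, e⟩ := hg n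
  obtain ⟨l₁, a₁, b₁, k₁, e₁⟩ := f.comm h
  obtain ⟨l₂, a₂, b₂, k₂, e₂⟩ := f.comm h'
  obtain ⟨l₃, a₃, b₃, k₃, e₃⟩ := hf (g'.idx n)
  obtain ⟨l, hl₁, hl₂, hl₃⟩ := X.exists_ge₃ l₁ l₂ l₃
  refine ⟨l, a₁.trans hl₁, b₃.trans hl₃, max (max k k₃) (max k₁ k₂), fun i hi => ?_⟩
  simp only [ge_iff_le, max_le_iff] at hi
  have e₁' := bond_lift b₁ a₁ (f := f.app i m ≫ Y.bond h) (e₁ i hi.2.1) hl₁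
  have e₂' := bond_lift b₂ a₂ (f := f.app i m ≫ Y.bond h') (e₂ i hi.2.2) hl₂
  have e₃' := bond_lift a₃ b₃ (e₃ i hi.1.2) hl₃
  change X.bond _ ≫ f.app i _ ≫ g.app i _ = X.bond _ ≫ f'.app i _ ≫ g'.app i _
  rw [← reassoc_of% e₁', e i hi.1.1, ← reassoc_of% e₃', ← reassoc_of% e₂']

end SMor

end InvSystem

open InvSystem

/-- The category `pro-C`: inverse systems in `C` and equivalence classes of morphisms `(f, f_μ)`. -/
structure Pro (C : Type v) [Category.{w} C] where
  sys : InvSystem.{u} C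

/-- The category `pro*-C`: inverse systems in `C` and equivalence classes of `S*`-morphisms. -/
structure ProStar (C : Type v) [Category.{w} C] where
  sys : InvSystem.{u} C

section ProCategories

variable {C : Type v} [Category.{w} C]

instance Pro.category : Category (Pro.{u} C) where
  Hom X Y := _root_.Quotient (Mor.setoid X.sys Y.sys)
  id X := ⟦Mor.id X.sys⟧
  comp f g := _root_.Quotient.map₂ Mor.comp (fun _ _ hf _ _ hg => Mor.comp_equiv hf hg) f g
  id_comp f := _root_.Quotient.inductionOn f fun f => _root_.Quotient.sound fun m =>
    ⟨f.idx m, le_rfl, le_rfl, by simp [Mor.comp, Mor.id]⟩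
  comp_id f := _root_.Quotient.inductionOn f fun f => _root_.Quotient.sound fun m =>
    ⟨f.idx m, le_rfl, le_rfl, by simp [Mor.comp, Mor.id]⟩
  assoc f g h := _root_.Quotient.inductionOn₃ f g h fun f g h => _root_.Quotient.sound fun m =>
    ⟨_, le_rfl, le_rfl, by simp [Mor.comp]⟩

instance ProStar.category : Category (ProStar.{u} C) where
  Hom X Y := _root_.Quotient (SMor.setoid X.sys Y.sys)
  id X := ⟦SMor.id X.sys⟧
  comp f g := _root_.Quotient.map₂ SMor.comp (fun _ _ hf _ _ hg => SMor.comp_equiv hf hg) f g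
  id_comp f := _root_.Quotient.inductionOn f fun f => _root_.Quotient.sound fun m =>
    ⟨f.idx m, le_rfl, le_rfl, 0, fun _ _ => by simp [SMor.comp, SMor.id]⟩
  comp_id f := _root_.Quotient.inductionOn f fun f => _root_.Quotient.sound fun m =>
    ⟨f.idx m, le_rfl, le_rfl, 0, fun _ _ => by simp [SMor.comp, SMor.id]⟩
  assoc f g h := _root_.Quotient.inductionOn₃ f g h fun f g h => _root_.Quotient.sound fun m =>
    ⟨_, le_rfl, le_rfl, 0, fun _ _ => by simp [SMor.comp]⟩

/-- The functor `J : pro-C ⥤ pro*-C`, `J [(f, f_μ)] = [(f, f^n_μ)]` with `f^n_μ = f_μ`. -/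
def proToProStar (C : Type v) [Category.{w} C] : Pro.{u} C ⥤ ProStar.{u} C where
  obj X := ⟨X.sys⟩
  map f := _root_.Quotient.map SMor.ofMor (fun _ _ h m => by
    obtain ⟨l, a, b, e⟩ := h m
    exact ⟨l, a, b, 0, fun _ _ => e⟩) f
  map_id _ := rfl
  map_comp f g := _root_.Quotient.inductionOn₂ f g fun _ _ => rfl

/-- `C` as the category of rudimentary systems in `pro-C`. -/
def rudPro (C : Type v) [Category.{w} C] : C ⥤ Pro.{u} C where
  obj A := ⟨rud A⟩
  map f := ⟦{ idx := fun m => m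
              app := fun _ => f
              comm := fun {m _} _ => ⟨m, le_rfl, le_rfl, by simp [rud]⟩ }⟧
  map_id _ := rfl
  map_comp _ _ := rfl

end ProCategories

/-! ## The homotopy category and polyhedra -/

/-- The homotopy category of topological spaces. -/
structure HTop where
  space : TopCat.{u}

namespace HTop

/-- A topological space, as an object of `HTop`. -/
abbrev of (X : Type u) [TopologicalSpace X] : HTop.{u} := ⟨TopCat.of X⟩

instance homotopySetoid (X Y : Type u) [TopologicalSpace X] [TopologicalSpace Y] :
    Setoid C(X, Y) :=
  ⟨ContinuousMap.Homotopic, ContinuousMap.Homotopic.equivalence⟩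

instance category : Category.{u} HTop.{u} where
  Hom X Y := _root_.Quotient (homotopySetoid X.space Y.space)
  id X := _root_.Quotient.mk _ (ContinuousMap.id X.space)
  comp {X Y Z} f g := _root_.Quotient.map₂ (sa := homotopySetoid X.space Y.space)
    (sb := homotopySetoid Y.space Z.space) (sc := homotopySetoid X.space Z.space)
    (fun f g => g.comp f) (fun _ _ hf _ _ hg => ContinuousMap.Homotopic.comp hg hf) f g
  id_comp f := _root_.Quotient.inductionOn f fun _ => rfl
  comp_id f := _root_.Quotient.inductionOn f fun _ => rfl
  assoc f g h := _root_.Quotient.inductionOn₃ f g h fun _ _ _ => rfl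

/-- The homotopy class of a continuous map. -/
def homMk {X Y : Type u} [TopologicalSpace X] [TopologicalSpace Y] (f : C(X, Y)) :
    of X ⟶ of Y :=
  _root_.Quotient.mk (homotopySetoid X Y) f

/-- The topological product of two spaces, as an object of `HTop`. -/
def prod (X Y : HTop.{u}) : HTop.{u} := of (X.space × Y.space)

/-- The product `f × g` of two homotopy classes. -/
def prodMap {X X' Y Y' : HTop.{u}} (f : X ⟶ X') (g : Y ⟶ Y') : prod X Y ⟶ prod X' Y' :=
  _root_.Quotient.map₂ (sa := homotopySetoid X.space X'.space) (sb := homotopySetoid Y.space Y'.space)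
    (sc := homotopySetoid (X.space × Y.space) (X'.space × Y'.space))
    ContinuousMap.prodMap (fun _ _ hf _ _ hg => ContinuousMap.Homotopic.prodMap hf hg) f g

lemma prodMap_id (X Y : HTop.{u}) : prodMap (𝟙 X) (𝟙 Y) = 𝟙 (prod X Y) := rfl

lemma prodMap_comp {X X' X'' Y Y' Y'' : HTop.{u}} (f : X ⟶ X') (f' : X' ⟶ X'') (g : Y ⟶ Y')
    (g' : Y' ⟶ Y'') : prodMap f g ≫ prodMap f' g' = prodMap (f ≫ f') (g ≫ g') :=
  _root_.Quotient.inductionOn₂ f f' fun _ _ => _root_.Quotient.inductionOn₂ g g' fun _ _ => rfl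

end HTop

/-- The points of the polyhedron `|K|` of an abstract simplicial complex `K`: barycentric
coordinates whose support is a simplex of `K`. -/
def Polyhedron {V : Type u} (K : PreAbstractSimplicialComplex V) : Type u :=
  {t : V →₀ ℝ // (∀ v, 0 ≤ t v) ∧ (t.sum fun _ r => r) = 1 ∧ t.support ∈ K}

namespace Polyhedron

/-- The closed simplex of `|K|` spanned by `s`. -/
def ClosedSimplex {V : Type u} (K : PreAbstractSimplicialComplex V) (s : Finset V) : Type u :=
  {t : Polyhedron K // t.1.support ⊆ s}

/-- The Euclidean topology of a closed simplex, given by the barycentric coordinates. -/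
instance closedSimplexTopology {V : Type u} (K : PreAbstractSimplicialComplex V) (s : Finset V) :
    TopologicalSpace (ClosedSimplex K s) :=
  TopologicalSpace.induced (fun t (v : V) => t.1.1 v) (inferInstance : TopologicalSpace (V → ℝ))

/-- The weak topology of `|K|`: a set is open if and only if it meets every closed simplex in an
open subset of that simplex. -/
instance topology {V : Type u} (K : PreAbstractSimplicialComplex V) : TopologicalSpace (Polyhedron K) :=
  ⨆ s : {s : Finset V // s ∈ K},
    TopologicalSpace.coinduced (fun t : ClosedSimplex K s.1 => t.1) (closedSimplexTopology K s.1)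

end Polyhedron

/-- `X` has the homotopy type of a polyhedron, i.e. `X` is an object of `HPol`. -/
def HTop.IsHPol (X : HTop.{u}) : Prop :=
  ∃ (V : Type u) (K : PreAbstractSimplicialComplex V),
    Nonempty (ContinuousMap.HomotopyEquiv X.space (Polyhedron K))

/-- The inverse system lies in `HPol`. -/
def InvSystem.InHPol (X : InvSystem.{u} HTop.{u}) : Prop :=
  ∀ l, (X.obj l).IsHPol

/-! ## Expansions -/

/-- An `HPol`-expansion `p : X ⟶ 𝐗` of a space `X`. -/
structure HPolExpansion (X : HTop.{u}) where
  sys : InvSystem.{u} HTop.{u}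
  inHPol : sys.InHPol
  proj : (rudPro HTop.{u}).obj X ⟶ (⟨sys⟩ : Pro.{u} HTop.{u})
  existsUnique_lift : ∀ Y : InvSystem.{u} HTop.{u}, Y.InHPol →
    ∀ h : (rudPro HTop.{u}).obj X ⟶ (⟨Y⟩ : Pro.{u} HTop.{u}),
      ∃! f : (⟨sys⟩ : Pro.{u} HTop.{u}) ⟶ ⟨Y⟩, proj ≫ f = h

/-- The morphism `p* : X ⟶ 𝐗` of `pro*-HTop` is an `HPol*`-expansion of `X`. -/
def IsHPolStarExpansion {X : HTop.{u}} {S : InvSystem.{u} HTop.{u}}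
    (p : (⟨rud X⟩ : ProStar.{u} HTop.{u}) ⟶ ⟨S⟩) : Prop :=
  S.InHPol ∧ ∀ Y : InvSystem.{u} HTop.{u}, Y.InHPol →
    ∀ h : (⟨rud X⟩ : ProStar.{u} HTop.{u}) ⟶ ⟨Y⟩,
      ∃! f : (⟨S⟩ : ProStar.{u} HTop.{u}) ⟶ ⟨Y⟩, p ≫ f = h

/-- The product system `𝐗 × 𝐘 = (X_λ × Y_μ, p_{λλ'} × q_{μμ'}, Λ × M)`. -/
def InvSystem.prod (S T : InvSystem.{u} HTop.{u}) : InvSystem.{u} HTop.{u} where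
  Idx := S.Idx × T.Idx
  directed := ⟨fun a b => by
    obtain ⟨c, hc, hc'⟩ := exists_ge_ge a.1 b.1
    obtain ⟨d, hd, hd'⟩ := exists_ge_ge a.2 b.2
    exact ⟨(c, d), ⟨hc, hd⟩, ⟨hc', hd'⟩⟩⟩
  obj i := HTop.prod (S.obj i.1) (T.obj i.2)
  bond {i j} h := HTop.prodMap (S.bond (Prod.le_def.1 h).1) (T.bond (Prod.le_def.1 h).2)
  bond_refl i := by rw [S.bond_refl, T.bond_refl, HTop.prodMap_id]
  bond_trans _ _ := by rw [HTop.prodMap_comp, S.bond_trans, T.bond_trans]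

/-- The `S*`-morphism given by the maps `p^n_λ × q^n_μ : X × Y ⟶ X_λ × Y_μ`. -/
def InvSystem.SMor.prod {X Y : HTop.{u}} {S T : InvSystem.{u} HTop.{u}} (p : SMor (rud X) S)
    (q : SMor (rud Y) T) : SMor (rud (HTop.prod X Y)) (S.prod T) where
  idx _ := PUnit.unit
  app n i := HTop.prodMap (p.app n i.1) (q.app n i.2)
  comm {m m'} hm := by
    obtain ⟨_, _, _, a, ha⟩ := p.comm hm.1
    obtain ⟨_, _, _, b, hb⟩ := q.comm hm.2
    refine ⟨PUnit.unit, le_rfl, le_rfl, max a b, fun n' hn' => ?_⟩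
    have ea := ha n' ((le_max_left _ _).trans hn')
    have eb := hb n' ((le_max_right _ _).trans hn')
    simp only [rud, Category.id_comp] at ea eb ⊢
    exact (HTop.prodMap_comp (p.app n' m'.1) (S.bond hm.1) (q.app n' m'.2) (T.bond hm.2)).trans
      ((congrArg₂ HTop.prodMap ea eb).trans (Category.id_comp _).symm)

/-- The morphism `p* × q* : X × Y ⟶ 𝐗 × 𝐘` of `pro*-HTop`. -/
def ProStar.prodHom {X Y : HTop.{u}} {S T : InvSystem.{u} HTop.{u}}
    (p : (⟨rud X⟩ : ProStar.{u} HTop.{u}) ⟶ ⟨S⟩) (q : (⟨rud Y⟩ : ProStar.{u} HTop.{u}) ⟶ ⟨T⟩) :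
    (⟨rud (HTop.prod X Y)⟩ : ProStar.{u} HTop.{u}) ⟶ ⟨S.prod T⟩ :=
  _root_.Quotient.map₂ (sa := SMor.setoid (rud X) S) (sb := SMor.setoid (rud Y) T)
    (sc := SMor.setoid (rud (HTop.prod X Y)) (S.prod T)) SMor.prod
    (fun _ _ hf _ _ hg i => by
      obtain ⟨_, _, _, a, ha⟩ := hf i.1
      obtain ⟨_, _, _, b, hb⟩ := hg i.2
      refine ⟨PUnit.unit, le_rfl, le_rfl, max a b, fun n' hn' => ?_⟩
      have ea := ha n' ((le_max_left _ _).trans hn')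
      have eb := hb n' ((le_max_right _ _).trans hn')
      simp only [rud, Category.id_comp] at ea eb ⊢
      exact congrArg₂ HTop.prodMap ea eb) p q

/-! ## Coarse shape morphisms -/

namespace HPolExpansion

variable {X : HTop.{u}}

/-- The natural isomorphism `i : 𝐗 ⟶ 𝐗'` of `pro-HTop` between two expansions `p`, `p'` of `X`,
i.e. the unique morphism with `i p = p'`. -/
noncomputable def trans (p p' : HPolExpansion X) :
    (⟨p.sys⟩ : Pro.{u} HTop.{u}) ⟶ ⟨p'.sys⟩ :=
  (p.existsUnique_lift p'.sys p'.inHPol p'.proj).choose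

lemma proj_trans (p p' : HPolExpansion X) : p.proj ≫ p.trans p' = p'.proj :=
  (p.existsUnique_lift p'.sys p'.inHPol p'.proj).choose_spec.1

lemma hom_ext (p : HPolExpansion X) {Y : InvSystem.{u} HTop.{u}} (hY : Y.InHPol)
    {f g : (⟨p.sys⟩ : Pro.{u} HTop.{u}) ⟶ ⟨Y⟩} (h : p.proj ≫ f = p.proj ≫ g) : f = g :=
  (p.existsUnique_lift Y hY (p.proj ≫ g)).unique h rfl

lemma trans_self (p : HPolExpansion X) : p.trans p = 𝟙 _ :=
  p.hom_ext p.inHPol (by rw [proj_trans, Category.comp_id])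

lemma trans_trans (p p' p'' : HPolExpansion X) : p.trans p' ≫ p'.trans p'' = p.trans p'' :=
  p.hom_ext p''.inHPol (by rw [← Category.assoc, proj_trans, proj_trans, proj_trans])

/-- The isomorphism `i* = J(i)` of `pro*-HTop`. -/
noncomputable def transStar (p p' : HPolExpansion X) :
    (⟨p.sys⟩ : ProStar.{u} HTop.{u}) ⟶ ⟨p'.sys⟩ :=
  (proToProStar HTop.{u}).map (p.trans p')

lemma transStar_self (p : HPolExpansion X) : p.transStar p = 𝟙 _ := by
  rw [transStar, trans_self]; rfl

lemma transStar_trans (p p' p'' : HPolExpansion X) :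
    p.transStar p' ≫ p'.transStar p'' = p.transStar p'' := by
  rw [transStar, transStar, transStar, ← trans_trans p p' p'']
  exact ((proToProStar HTop.{u}).map_comp (p.trans p') (p'.trans p'')).symm

lemma transStar_trans_assoc (p p' p'' : HPolExpansion X) {Z : ProStar.{u} HTop.{u}}
    (f : (⟨p''.sys⟩ : ProStar.{u} HTop.{u}) ⟶ Z) :
    p.transStar p' ≫ p'.transStar p'' ≫ f = p.transStar p'' ≫ f := by
  rw [← Category.assoc, transStar_trans]

end HPolExpansion

/-- A morphism `f* : 𝐗 ⟶ 𝐘` of `pro*-HTop`, where `X ⟶ 𝐗` and `Y ⟶ 𝐘` are `HPol`-expansions. -/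
structure CoarseShapeRep (X Y : HTop.{u}) where
  source : HPolExpansion X
  target : HPolExpansion Y
  hom : (⟨source.sys⟩ : ProStar.{u} HTop.{u}) ⟶ ⟨target.sys⟩

namespace CoarseShapeRep

variable {X Y Z : HTop.{u}}

/-- `f* ∼ f'*` if `f'* i* = j* f*`. -/
def Equiv (f f' : CoarseShapeRep X Y) : Prop :=
  f.source.transStar f'.source ≫ f'.hom = f.hom ≫ f.target.transStar f'.target

lemma Equiv.refl (f : CoarseShapeRep X Y) : f.Equiv f := by
  simp [Equiv, HPolExpansion.transStar_self]

lemma Equiv.symm {f g : CoarseShapeRep X Y} (h : f.Equiv g) : g.Equiv f := by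
  have h' : f.source.transStar g.source ≫ g.hom = f.hom ≫ f.target.transStar g.target := h
  have : g.source.transStar f.source ≫ f.hom ≫ f.target.transStar g.target ≫
      g.target.transStar f.target = g.hom ≫ g.target.transStar f.target := by
    rw [← reassoc_of% h', HPolExpansion.transStar_trans_assoc, HPolExpansion.transStar_self,
      Category.id_comp]
  rw [HPolExpansion.transStar_trans, HPolExpansion.transStar_self, Category.comp_id] at this
  exact this

lemma Equiv.trans {f g k : CoarseShapeRep X Y} (h : f.Equiv g) (h' : g.Equiv k) : f.Equiv k := by
  have e : f.source.transStar g.source ≫ g.hom = f.hom ≫ f.target.transStar g.target := h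
  have e' : g.source.transStar k.source ≫ k.hom = g.hom ≫ g.target.transStar k.target := h'
  change f.source.transStar k.source ≫ k.hom = f.hom ≫ f.target.transStar k.target
  rw [← HPolExpansion.transStar_trans f.source g.source, Category.assoc, e', reassoc_of% e,
    HPolExpansion.transStar_trans]

instance setoid (X Y : HTop.{u}) : Setoid (CoarseShapeRep X Y) :=
  ⟨Equiv, Equiv.refl, Equiv.symm, Equiv.trans⟩

/-- The composite of `f* : 𝐗 ⟶ 𝐘` and `g* : 𝐘' ⟶ 𝐙`, where `𝐘` and `𝐘'` are identified along the
natural isomorphism. -/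
noncomputable def comp (f : CoarseShapeRep X Y) (g : CoarseShapeRep Y Z) : CoarseShapeRep X Z where
  source := f.source
  target := g.target
  hom := f.hom ≫ f.target.transStar g.source ≫ g.hom

lemma comp_equiv {f f' : CoarseShapeRep X Y} {g g' : CoarseShapeRep Y Z} (hf : f.Equiv f')
    (hg : g.Equiv g') : (f.comp g).Equiv (f'.comp g') := by
  have e : f.source.transStar f'.source ≫ f'.hom = f.hom ≫ f.target.transStar f'.target := hf
  have e' : g.source.transStar g'.source ≫ g'.hom = g.hom ≫ g.target.transStar g'.target := hg
  change f.source.transStar f'.source ≫ f'.hom ≫ f'.target.transStar g'.source ≫ g'.hom =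
    (f.hom ≫ f.target.transStar g.source ≫ g.hom) ≫ g.target.transStar g'.target
  rw [reassoc_of% e, HPolExpansion.transStar_trans_assoc, Category.assoc, Category.assoc, ← e',
    HPolExpansion.transStar_trans_assoc]

end CoarseShapeRep

/-- A coarse shape morphism `F* = ⟨f*⟩ : X ⟶ Y`, i.e. a morphism of `Sh*`. -/
def CoarseShapeHom (X Y : HTop.{u}) : Type (u + 1) :=
  _root_.Quotient (CoarseShapeRep.setoid X Y)

namespace CoarseShapeHom

variable {W X Y Z : HTop.{u}}

/-- The coarse shape morphism `⟨f*⟩`. -/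
def mk (p : HPolExpansion X) (q : HPolExpansion Y)
    (f : (⟨p.sys⟩ : ProStar.{u} HTop.{u}) ⟶ ⟨q.sys⟩) : CoarseShapeHom X Y :=
  _root_.Quotient.mk (CoarseShapeRep.setoid X Y) ⟨p, q, f⟩

/-- The composite `G* F*` in `Sh*`, written in diagrammatic order. -/
noncomputable def comp (F : CoarseShapeHom X Y) (G : CoarseShapeHom Y Z) : CoarseShapeHom X Z :=
  _root_.Quotient.map₂ CoarseShapeRep.comp
    (fun _ _ hf _ _ hg => CoarseShapeRep.comp_equiv hf hg) F G

/-- The identity of `X` in `Sh*`, computed from an expansion of `X`. -/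
def ident (p : HPolExpansion X) : CoarseShapeHom X X := mk p p (𝟙 _)

lemma mk_comp_mk (p : HPolExpansion X) (q : HPolExpansion Y) (r : HPolExpansion Z)
    (f : (⟨p.sys⟩ : ProStar.{u} HTop.{u}) ⟶ ⟨q.sys⟩)
    (g : (⟨q.sys⟩ : ProStar.{u} HTop.{u}) ⟶ ⟨r.sys⟩) :
    comp (mk p q f) (mk q r g) = mk p r (f ≫ g) :=
  congrArg (mk p r) (by rw [HPolExpansion.transStar_self, Category.id_comp])

lemma mk_eq_mk (p p' : HPolExpansion X) (q q' : HPolExpansion Y)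
    {f : (⟨p.sys⟩ : ProStar.{u} HTop.{u}) ⟶ ⟨q.sys⟩}
    {f' : (⟨p'.sys⟩ : ProStar.{u} HTop.{u}) ⟶ ⟨q'.sys⟩} :
    mk p q f = mk p' q' f' ↔ p.transStar p' ≫ f' = f ≫ q.transStar q' :=
  _root_.Quotient.eq (r := CoarseShapeRep.setoid X Y)

lemma ident_eq (p p' : HPolExpansion X) : ident p = ident p' :=
  (mk_eq_mk _ _ _ _).2 (by simp)

/-- Every coarse shape morphism has exactly one representative for each pair of expansions. -/
lemma existsUnique_rep (F : CoarseShapeHom X Y) (p : HPolExpansion X) (q : HPolExpansion Y) :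
    ∃! f, mk p q f = F := by
  refine _root_.Quotient.inductionOn F fun F => ?_
  refine ⟨p.transStar F.source ≫ F.hom ≫ F.target.transStar q, ?_, fun f hf => ?_⟩
  · refine (mk_eq_mk p F.source q F.target).2 ?_
    simp [HPolExpansion.transStar_trans, HPolExpansion.transStar_self]
  · have h := (mk_eq_mk p F.source q F.target).1 hf
    rw [reassoc_of% h, HPolExpansion.transStar_trans, HPolExpansion.transStar_self,
      Category.comp_id]

lemma ident_comp (p : HPolExpansion X) (F : CoarseShapeHom X Y) : comp (ident p) F = F := by
  refine _root_.Quotient.inductionOn F fun F => ?_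
  obtain ⟨f, hf, -⟩ := existsUnique_rep (_root_.Quotient.mk _ F) p F.target
  rw [← hf, ident, mk_comp_mk, Category.id_comp]

lemma comp_ident (q : HPolExpansion Y) (F : CoarseShapeHom X Y) : comp F (ident q) = F := by
  refine _root_.Quotient.inductionOn F fun F => ?_
  obtain ⟨f, hf, -⟩ := existsUnique_rep (_root_.Quotient.mk _ F) F.source q
  rw [← hf, ident, mk_comp_mk, Category.comp_id]

lemma comp_assoc (F : CoarseShapeHom W X) (G : CoarseShapeHom X Y) (H : CoarseShapeHom Y Z) :
    comp (comp F G) H = comp F (comp G H) :=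
  _root_.Quotient.inductionOn₃ F G H fun F G H =>
    congrArg (mk F.source H.target) (by simp [CoarseShapeRep.comp])

/-- `F* = S*(f)`: for expansions `p : X ⟶ 𝐗`, `q : Y ⟶ 𝐘` and the morphism `f' : 𝐗 ⟶ 𝐘` of
`pro-HTop` with `f' p = q f`, the coarse shape morphism `F*` is the class of `J(f')`. -/
def IsInducedBy (F : CoarseShapeHom X Y) (f : X ⟶ Y) : Prop :=
  ∃ (p : HPolExpansion X) (q : HPolExpansion Y)
    (f' : (⟨p.sys⟩ : Pro.{u} HTop.{u}) ⟶ ⟨q.sys⟩),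
    p.proj ≫ f' = (rudPro HTop.{u}).map f ≫ q.proj ∧
      F = mk p q ((proToProStar HTop.{u}).map f')

/-- The coarse shape morphism `S*(f)` does not depend on the choice of the expansions. -/
lemma IsInducedBy.unique {F F' : CoarseShapeHom X Y} {f : X ⟶ Y} (h : F.IsInducedBy f)
    (h' : F'.IsInducedBy f) : F = F' := by
  obtain ⟨p, q, g, hg, rfl⟩ := h
  obtain ⟨p', q', g', hg', rfl⟩ := h'
  refine (mk_eq_mk p p' q q').2 ?_
  have key : p.trans p' ≫ g' = g ≫ q.trans q' := p.hom_ext q'.inHPol (by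
    rw [← Category.assoc, p.proj_trans, hg', ← Category.assoc, hg, Category.assoc, q.proj_trans])
  have := congrArg (fun k => (proToProStar HTop.{u}).map k) key
  simp only [Functor.map_comp] at this
  exact this

/-- `S*(f)` exists as soon as both spaces have expansions. -/
lemma exists_isInducedBy (p : HPolExpansion X) (q : HPolExpansion Y) (f : X ⟶ Y) :
    ∃ F : CoarseShapeHom X Y, F.IsInducedBy f := by
  obtain ⟨f', hf', -⟩ :=
    p.existsUnique_lift q.sys q.inHPol ((rudPro HTop.{u}).map f ≫ q.proj)
  exact ⟨_, p, q, f', hf', rfl⟩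

end CoarseShapeHom

/-- `W` with coarse shape morphisms `W ⟶ X` and `W ⟶ Y` is a product of `X` and `Y` in `Sh*`. -/
def IsCoarseShapeProduct {W X Y : HTop.{u}} (πX : CoarseShapeHom W X) (πY : CoarseShapeHom W Y) :
    Prop :=
  ∀ (Z : HTop.{u}) (F : CoarseShapeHom Z X) (G : CoarseShapeHom Z Y),
    ∃! H : CoarseShapeHom Z W, H.comp πX = F ∧ H.comp πY = G

/-! Morphisms of Sh* are computed from `HPol`-expansions, whereas the hypotheses supply
`HPol*`-expansions, whose maps vary with `n`. Once `X` and `Y` have `HPol`-expansions whose product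
system expands `X × Y`, the theorem is formal. Products in HTop make the product system a product in
pro*-HTop (`ProStar.existsUnique_lift`), and a coarse shape morphism has exactly one representative
between given expansions (`CoarseShapeHom.existsUnique_rep`).

To find such `HPol`-expansions, all maps `p^n_λ` are taken as separate objects of a category of
objects under `X`, with arrows reversed (`Stage`). Testing the universal property of `p*` on
one-point systems gives two facts. A map `h` from `X` to an object of HPol is `f^n p^n_λ` for one
`λ` and all large `n` (`IsHPolStarExpansion.exists_factor`). Two sequences with `f^n p^n_λ = g^n
p^n_λ` for all large `n` agree for large `n` after a bonding map
(`IsHPolStarExpansion.exists_bond_eq`).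

The first fact applies to a single stage as the map `h`, so an equality known at that stage alone
spreads to all late stages of another index, where the second fact applies. Hence the category of
stages is filtered (`Stage.isFiltered`) and receives a final functor from a directed poset. Such a
functor is an ordinary inverse system, and it is an `HPol`-expansion. The same argument for `p* ×
q*` shows that the product of the systems for `p` and `q` expands `X × Y`
(`Stage.isHPolApproximation_prod`). -/

/-! ## Products in the homotopy category -/

namespace HTop

/-- The homotopy class of the first projection. -/
def fst (X Y : HTop.{u}) : prod X Y ⟶ X := homMk ContinuousMap.fst

/-- The homotopy class of the second projection. -/
def snd (X Y : HTop.{u}) : prod X Y ⟶ Y := homMk ContinuousMap.snd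

/-- The homotopy class with given components. -/
def lift {Z X Y : HTop.{u}} (f : Z ⟶ X) (g : Z ⟶ Y) : Z ⟶ prod X Y :=
  _root_.Quotient.map₂ (sa := homotopySetoid Z.space X.space) (sb := homotopySetoid Z.space Y.space)
    (sc := homotopySetoid Z.space (X.space × Y.space))
    ContinuousMap.prodMk (fun _ _ hf _ _ hg => ContinuousMap.Homotopic.prodMk hf hg) f g

lemma lift_fst {Z X Y : HTop.{u}} (f : Z ⟶ X) (g : Z ⟶ Y) : lift f g ≫ fst X Y = f :=
  _root_.Quotient.inductionOn₂ f g fun _ _ => rfl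

lemma lift_snd {Z X Y : HTop.{u}} (f : Z ⟶ X) (g : Z ⟶ Y) : lift f g ≫ snd X Y = g :=
  _root_.Quotient.inductionOn₂ f g fun _ _ => rfl

lemma lift_fst_snd {Z X Y : HTop.{u}} (h : Z ⟶ prod X Y) :
    lift (h ≫ fst X Y) (h ≫ snd X Y) = h :=
  _root_.Quotient.inductionOn h fun _ => rfl

lemma prod_hom_ext {Z X Y : HTop.{u}} {h k : Z ⟶ prod X Y} (h₁ : h ≫ fst X Y = k ≫ fst X Y)
    (h₂ : h ≫ snd X Y = k ≫ snd X Y) : h = k := by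
  rw [← lift_fst_snd h, h₁, h₂, lift_fst_snd]

lemma comp_lift {W Z X Y : HTop.{u}} (k : W ⟶ Z) (f : Z ⟶ X) (g : Z ⟶ Y) :
    k ≫ lift f g = lift (k ≫ f) (k ≫ g) :=
  _root_.Quotient.inductionOn₃ k f g fun _ _ _ => rfl

lemma lift_prodMap {Z X X' Y Y' : HTop.{u}} (f : Z ⟶ X) (g : Z ⟶ Y) (s : X ⟶ X') (t : Y ⟶ Y') :
    lift f g ≫ prodMap s t = lift (f ≫ s) (g ≫ t) :=
  _root_.Quotient.inductionOn₂ f g fun _ _ => _root_.Quotient.inductionOn₂ s t fun _ _ => rfl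

lemma prodMap_fst {X X' Y Y' : HTop.{u}} (f : X ⟶ X') (g : Y ⟶ Y') :
    prodMap f g ≫ fst X' Y' = fst X Y ≫ f :=
  _root_.Quotient.inductionOn₂ f g fun _ _ => rfl

lemma prodMap_snd {X X' Y Y' : HTop.{u}} (f : X ⟶ X') (g : Y ⟶ Y') :
    prodMap f g ≫ snd X' Y' = snd X Y ≫ g :=
  _root_.Quotient.inductionOn₂ f g fun _ _ => rfl

end HTop

/-! ## Products in `pro-HTop` and `pro*-HTop` -/

namespace InvSystem

variable {Z S T : InvSystem.{u} HTop.{u}}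

/-- The first projection of a product system, read off at the index `j` of the second factor. -/
def Mor.fst (S T : InvSystem.{u} HTop.{u}) (j : T.Idx) : Mor (S.prod T) S where
  idx i := (i, j)
  app i := HTop.fst (S.obj i) (T.obj j)
  comm {_ i'} h := ⟨(i', j), ⟨h, le_rfl⟩, ⟨le_rfl, le_rfl⟩,
    (congrArg (· ≫ HTop.fst _ _ ≫ S.bond h) ((S.prod T).bond_refl (i', j))).trans
      ((Category.id_comp _).trans (HTop.prodMap_fst _ _).symm)⟩

/-- The second projection of a product system, read off at the index `i` of the first factor. -/
def Mor.snd (S T : InvSystem.{u} HTop.{u}) (i : S.Idx) : Mor (S.prod T) T where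
  idx j := (i, j)
  app j := HTop.snd (S.obj i) (T.obj j)
  comm {_ j'} h := ⟨(i, j'), ⟨le_rfl, h⟩, ⟨le_rfl, le_rfl⟩,
    (congrArg (· ≫ HTop.snd _ _ ≫ T.bond h) ((S.prod T).bond_refl (i, j'))).trans
      ((Category.id_comp _).trans (HTop.prodMap_snd _ _).symm)⟩

/-- Over a common upper bound `k` of `j` and `j'`, both become the projection of the term at `(i,
k)` to its first factor. The class in pro-HTop is therefore independent of the auxiliary index. -/
lemma Mor.fst_equiv (j j' : T.Idx) : (Mor.fst S T j).Equiv (Mor.fst S T j') := fun i => by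
  obtain ⟨k, hk, hk'⟩ := exists_ge_ge j j'
  exact ⟨(i, k), ⟨le_rfl, hk⟩, ⟨le_rfl, hk'⟩,
    (HTop.prodMap_fst _ _).trans (HTop.prodMap_fst _ _).symm⟩

lemma Mor.snd_equiv (i i' : S.Idx) : (Mor.snd S T i).Equiv (Mor.snd S T i') := fun j => by
  obtain ⟨k, hk, hk'⟩ := exists_ge_ge i i'
  exact ⟨(k, j), ⟨hk, le_rfl⟩, ⟨hk', le_rfl⟩,
    (HTop.prodMap_snd _ _).trans (HTop.prodMap_snd _ _).symm⟩

/-- The `S*`-morphism into a product system with given components. -/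
noncomputable def SMor.lift (f : SMor Z S) (g : SMor Z T) : SMor Z (S.prod T) where
  idx i := (exists_ge_ge (f.idx i.1) (g.idx i.2)).choose
  app n i := HTop.lift
    (Z.bond (exists_ge_ge (f.idx i.1) (g.idx i.2)).choose_spec.1 ≫ f.app n i.1)
    (Z.bond (exists_ge_ge (f.idx i.1) (g.idx i.2)).choose_spec.2 ≫ g.app n i.2)
  comm {i i'} h := by
    obtain ⟨l₁, a₁, b₁, n₁, e₁⟩ := f.comm h.1
    obtain ⟨l₂, a₂, b₂, n₂, e₂⟩ := g.comm h.2
    obtain ⟨l₃, hl₁, hl₂⟩ := exists_ge_ge l₁ l₂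
    -- The indices chosen for `i` and `i'` are unrelated to those where the components become
    -- compatible, so `l` has to dominate all of them.
    obtain ⟨l, c, c', hl⟩ := Z.exists_ge₃ (exists_ge_ge (f.idx i.1) (g.idx i.2)).choose
      (exists_ge_ge (f.idx i'.1) (g.idx i'.2)).choose l₃
    refine ⟨l, c, c', max n₁ n₂, fun n hn => ?_⟩
    refine (congrArg (Z.bond c' ≫ ·) (HTop.lift_prodMap _ _ _ _)).trans
      ((HTop.comp_lift _ _ _).trans ((congrArg₂ HTop.lift ?_ ?_).trans
        (HTop.comp_lift _ _ _).symm))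
    · rw [Category.assoc, reassoc_of% Z.bond_trans, reassoc_of% Z.bond_trans]
      exact bond_lift (f := f.app n i'.1 ≫ S.bond h.1) b₁ a₁ (e₁ n (le_of_max_le_left hn))
        (hl₁.trans hl)
    · rw [Category.assoc, reassoc_of% Z.bond_trans, reassoc_of% Z.bond_trans]
      exact bond_lift (f := g.app n i'.2 ≫ T.bond h.2) b₂ a₂ (e₂ n (le_of_max_le_right hn))
        (hl₂.trans hl)

lemma SMor.lift_fst (f : SMor Z S) (g : SMor Z T) (j : T.Idx) :
    ((f.lift g).comp (ofMor (Mor.fst S T j))).Equiv f := fun i =>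
  ⟨_, le_rfl, (exists_ge_ge (f.idx i) (g.idx j)).choose_spec.1, 0, fun n _ => by
    rw [Z.bond_refl, Category.id_comp]
    exact HTop.lift_fst _ _⟩

lemma SMor.lift_snd (f : SMor Z S) (g : SMor Z T) (i : S.Idx) :
    ((f.lift g).comp (ofMor (Mor.snd S T i))).Equiv g := fun j =>
  ⟨_, le_rfl, (exists_ge_ge (f.idx i) (g.idx j)).choose_spec.2, 0, fun n _ => by
    rw [Z.bond_refl, Category.id_comp]
    exact HTop.lift_snd _ _⟩

/-- The components of the map at index `(i, j)` are seen only by the first projection read at `j`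
and the second read at `i`; hence all auxiliary indices occur in the hypotheses. -/
lemma SMor.prod_ext {h k : SMor Z (S.prod T)}
    (h₁ : ∀ j, (h.comp (ofMor (Mor.fst S T j))).Equiv (k.comp (ofMor (Mor.fst S T j))))
    (h₂ : ∀ i, (h.comp (ofMor (Mor.snd S T i))).Equiv (k.comp (ofMor (Mor.snd S T i)))) :
    h.Equiv k := fun i => by
  obtain ⟨l₁, a₁, b₁, n₁, e₁⟩ := h₁ i.2 i.1
  obtain ⟨l₂, a₂, b₂, n₂, e₂⟩ := h₂ i.1 i.2
  obtain ⟨l, hl₁, hl₂⟩ := exists_ge_ge l₁ l₂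
  refine ⟨l, a₁.trans hl₁, b₁.trans hl₁, max n₁ n₂, fun n hn => HTop.prod_hom_ext ?_ ?_⟩
  · exact (Category.assoc _ _ _).trans
      ((bond_lift a₁ b₁ (e₁ n (le_of_max_le_left hn)) hl₁).trans (Category.assoc _ _ _).symm)
  · exact (Category.assoc _ _ _).trans
      ((bond_lift a₂ b₂ (e₂ n (le_of_max_le_right hn)) hl₂).trans (Category.assoc _ _ _).symm)

end InvSystem

/-- The first projection of a product system in `pro-HTop`. -/
noncomputable def Pro.fst (S T : InvSystem.{u} HTop.{u}) :
    (⟨S.prod T⟩ : Pro.{u} HTop.{u}) ⟶ ⟨S⟩ :=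
  _root_.Quotient.mk (Mor.setoid _ _) (Mor.fst S T (Classical.arbitrary _))

/-- The second projection of a product system in `pro-HTop`. -/
noncomputable def Pro.snd (S T : InvSystem.{u} HTop.{u}) :
    (⟨S.prod T⟩ : Pro.{u} HTop.{u}) ⟶ ⟨T⟩ :=
  _root_.Quotient.mk (Mor.setoid _ _) (Mor.snd S T (Classical.arbitrary _))

lemma Pro.fst_eq {S T : InvSystem.{u} HTop.{u}} (j : T.Idx) :
    Pro.fst S T = _root_.Quotient.mk (Mor.setoid _ _) (Mor.fst S T j) :=
  _root_.Quotient.sound (Mor.fst_equiv _ _)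

lemma Pro.snd_eq {S T : InvSystem.{u} HTop.{u}} (i : S.Idx) :
    Pro.snd S T = _root_.Quotient.mk (Mor.setoid _ _) (Mor.snd S T i) :=
  _root_.Quotient.sound (Mor.snd_equiv _ _)

/-- The product system is a product in `pro*-HTop`. -/
lemma ProStar.existsUnique_lift {Z S T : InvSystem.{u} HTop.{u}}
    (f : (⟨Z⟩ : ProStar.{u} HTop.{u}) ⟶ ⟨S⟩) (g : (⟨Z⟩ : ProStar.{u} HTop.{u}) ⟶ ⟨T⟩) :
    ∃! h : (⟨Z⟩ : ProStar.{u} HTop.{u}) ⟶ ⟨S.prod T⟩,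
      h ≫ (proToProStar HTop.{u}).map (Pro.fst S T) = f ∧
        h ≫ (proToProStar HTop.{u}).map (Pro.snd S T) = g := by
  refine existsUnique_of_exists_of_unique ?_ fun h k hh hk => ?_
  · induction f using _root_.Quotient.inductionOn with | _ f
    induction g using _root_.Quotient.inductionOn with | _ g
    exact ⟨_root_.Quotient.mk (SMor.setoid _ _) (f.lift g),
      _root_.Quotient.sound (SMor.lift_fst f g _), _root_.Quotient.sound (SMor.lift_snd f g _)⟩
  · have e₁ := hh.1.trans hk.1.symm
    have e₂ := hh.2.trans hk.2.symm
    clear hh hk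
    induction h using _root_.Quotient.inductionOn with | _ h
    induction k using _root_.Quotient.inductionOn with | _ k
    refine _root_.Quotient.sound (SMor.prod_ext (fun j => ?_) fun i => ?_)
    -- The projection was defined with an arbitrary auxiliary index; it is moved to the one needed
    -- here.
    · rw [Pro.fst_eq j] at e₁
      exact _root_.Quotient.exact e₁
    · rw [Pro.snd_eq i] at e₂
      exact _root_.Quotient.exact e₂

/-! ## A criterion for `HPol`-expansions -/

/-- The morphisms `r i : X ⟶ 𝐗_i` are compatible, every morphism from `X` to an object of `HPol`
factors through some `r i`, and morphisms out of `𝐗_i` that agree after `r i` agree further up. -/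
structure IsHPolApproximation {X : HTop.{u}} (S : InvSystem.{u} HTop.{u})
    (r : ∀ i, X ⟶ S.obj i) : Prop where
  inHPol : S.InHPol
  comm : ∀ {i j : S.Idx} (h : i ≤ j), r j ≫ S.bond h = r i
  exists_factor : ∀ {P : HTop.{u}}, P.IsHPol → ∀ h : X ⟶ P,
    ∃ (i : S.Idx) (f : S.obj i ⟶ P), r i ≫ f = h
  exists_bond_eq : ∀ {P : HTop.{u}}, P.IsHPol → ∀ {i : S.Idx} (f g : S.obj i ⟶ P),
    r i ≫ f = r i ≫ g → ∃ (j : S.Idx) (h : i ≤ j), S.bond h ≫ f = S.bond h ≫ g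

namespace IsHPolApproximation

variable {X : HTop.{u}} {S : InvSystem.{u} HTop.{u}} {r : ∀ i, X ⟶ S.obj i}

lemma exists_bond_eq' (hr : IsHPolApproximation S r) {P : HTop.{u}} (hP : P.IsHPol) {i j : S.Idx}
    (f : S.obj i ⟶ P) (g : S.obj j ⟶ P) (e : r i ≫ f = r j ≫ g) :
    ∃ (l : S.Idx) (h : i ≤ l) (h' : j ≤ l), S.bond h ≫ f = S.bond h' ≫ g := by
  obtain ⟨k, hi, hj⟩ := exists_ge_ge i j
  obtain ⟨l, hl, el⟩ := hr.exists_bond_eq hP (S.bond hi ≫ f) (S.bond hj ≫ g) (by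
    rw [reassoc_of% hr.comm, reassoc_of% hr.comm, e])
  refine ⟨l, hi.trans hl, hj.trans hl, ?_⟩
  rwa [reassoc_of% S.bond_trans, reassoc_of% S.bond_trans] at el

/-- The morphism of systems given by the `r i`. -/
def mor (hr : IsHPolApproximation S r) : Mor (rud X) S where
  idx _ := PUnit.unit
  app := r
  comm h := ⟨PUnit.unit, le_rfl, le_rfl, congrArg (𝟙 X ≫ ·) (hr.comm h)⟩

/-- Each component of `h` factors through some `r i`. The factorizations are chosen independently,
but after composition with the `r i` they are compatible, so they become compatible further up;
uniqueness follows in the same way. -/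
lemma existsUnique_lift (hr : IsHPolApproximation S r) (Y : InvSystem.{u} HTop.{u})
    (hY : Y.InHPol) (h : (rudPro HTop.{u}).obj X ⟶ (⟨Y⟩ : Pro.{u} HTop.{u})) :
    ∃! f : (⟨S⟩ : Pro.{u} HTop.{u}) ⟶ ⟨Y⟩,
      (show (rudPro HTop.{u}).obj X ⟶ (⟨S⟩ : Pro.{u} HTop.{u}) from
        _root_.Quotient.mk (Mor.setoid _ _) hr.mor) ≫ f = h := by
  refine existsUnique_of_exists_of_unique ?_ fun f g hf hg => ?_
  · induction h using _root_.Quotient.inductionOn with | _ h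
    choose idx app e using fun m => hr.exists_factor (hY m) (h.app m : X ⟶ Y.obj m)
    refine ⟨_root_.Quotient.mk (Mor.setoid _ _)
      { idx := idx
        app := app
        comm := fun {m m'} hm => ?_ }, _root_.Quotient.sound fun m => ?_⟩
    · obtain ⟨l, a, b, e'⟩ := hr.exists_bond_eq' (hY m) (app m' ≫ Y.bond hm) (app m) (by
        obtain ⟨_, _, _, e'⟩ := h.comm hm
        rw [reassoc_of% e m', e m]
        exact (Category.id_comp _).symm.trans (e'.trans (Category.id_comp _)))
      exact ⟨l, b, a, e'⟩
    · exact ⟨PUnit.unit, le_rfl, le_rfl, congrArg (𝟙 X ≫ ·) (e m)⟩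
  · have e := hf.trans hg.symm
    clear hf hg
    induction f using _root_.Quotient.inductionOn with | _ f
    induction g using _root_.Quotient.inductionOn with | _ g
    refine _root_.Quotient.sound fun m => ?_
    obtain ⟨_, _, _, e'⟩ := _root_.Quotient.exact e m
    exact hr.exists_bond_eq' (hY m) (f.app m) (g.app m)
      ((Category.id_comp _).symm.trans (e'.trans (Category.id_comp _)))

/-- The `HPol`-expansion given by an approximation. -/
def expansion (hr : IsHPolApproximation S r) : HPolExpansion X where
  sys := S
  inHPol := hr.inHPol
  proj := _root_.Quotient.mk (Mor.setoid _ _) hr.mor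
  existsUnique_lift := hr.existsUnique_lift

end IsHPolApproximation

/-! ## The stages of an `HPol*`-expansion -/

section Stages

variable {X Y : HTop.{u}} {S T : InvSystem.{u} HTop.{u}}

/-- The maps `p^n_λ : X ⟶ X_λ` underlying an `S*`-morphism `p`. -/
structure Stage (p : SMor (rud X) S) where
  idx : S.Idx
  step : ℕ

namespace Stage

/-- The map `p^n_λ : X ⟶ X_λ`. -/
def proj {p : SMor (rud X) S} (a : Stage p) : X ⟶ S.obj a.idx := p.app a.step a.idx

end Stage

/-- The constant sequence `h` is an `S*`-morphism to the one-point system `P`. Its lift may vary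
with `n`, and equality in pro*-HTop holds only from some `n` on. -/
lemma IsHPolStarExpansion.exists_factor {p : SMor (rud X) S}
    (hp : IsHPolStarExpansion (_root_.Quotient.mk (SMor.setoid _ _) p)) {P : HTop.{u}}
    (hP : P.IsHPol) (h : X ⟶ P) : ∃ (l : S.Idx) (f : ℕ → (S.obj l ⟶ P)) (n : ℕ), ∀ n' ≥ n,
      (Stage.mk l n' : Stage p).proj ≫ f n' = h := by
  obtain ⟨f, hf, -⟩ := hp.2 (rud P) (fun _ => hP) (_root_.Quotient.mk (SMor.setoid _ _)
    { idx := fun _ => PUnit.unit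
      app := fun _ _ => h
      comm := fun _ => ⟨PUnit.unit, le_rfl, le_rfl, 0, fun _ _ => by simp [rud]⟩ })
  induction f using _root_.Quotient.inductionOn with | _ f
  obtain ⟨_, _, _, n, e⟩ := _root_.Quotient.exact hf PUnit.unit
  simp only [rud, Category.id_comp] at e
  exact ⟨_, fun n => f.app n PUnit.unit, n, e⟩

/-- Arbitrary sequences of maps into `P` are `S*`-morphisms to a one-point system, so uniqueness of
lifts applies to them. -/
lemma IsHPolStarExpansion.exists_bond_eq {p : SMor (rud X) S}
    (hp : IsHPolStarExpansion (_root_.Quotient.mk (SMor.setoid _ _) p)) {P : HTop.{u}}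
    (hP : P.IsHPol) {l : S.Idx} (f g : ℕ → (S.obj l ⟶ P)) (n : ℕ)
    (e : ∀ n' ≥ n, (Stage.mk l n' : Stage p).proj ≫ f n' =
      (Stage.mk l n' : Stage p).proj ≫ g n') :
    ∃ (k : S.Idx) (h : l ≤ k) (m : ℕ), ∀ m' ≥ m, S.bond h ≫ f m' = S.bond h ≫ g m' := by
  let φ (f : ℕ → (S.obj l ⟶ P)) : SMor S (rud P) :=
    { idx := fun _ => l
      app := fun n _ => f n
      comm := fun _ => ⟨l, le_rfl, le_rfl, 0, fun _ _ => by simp [rud]⟩ }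
  have e' : (p.comp (φ f)).Equiv (p.comp (φ g)) := fun _ =>
    ⟨_, le_rfl, le_rfl, n, fun n' hn' => congrArg ((rud X).bond le_rfl ≫ ·) (e n' hn')⟩
  have key := (hp.2 (rud P) (fun _ => hP)
    (_root_.Quotient.mk (SMor.setoid _ _) (p.comp (φ g)))).unique
    (y₁ := _root_.Quotient.mk (SMor.setoid _ _) (φ f))
    (y₂ := _root_.Quotient.mk (SMor.setoid _ _) (φ g)) (_root_.Quotient.sound e') rfl
  obtain ⟨k, h, _, m, e'⟩ := _root_.Quotient.exact key PUnit.unit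
  exact ⟨k, h, m, e'⟩

/-! ### The filtered category of stages -/

namespace Stage

/-- A morphism of stages is a morphism between their targets, under `X`, in the reverse
direction. -/
instance category (p : SMor (rud X) S) : SmallCategory (Stage p) where
  Hom a b := {φ : S.obj b.idx ⟶ S.obj a.idx // b.proj ≫ φ = a.proj}
  id a := ⟨𝟙 _, Category.comp_id _⟩
  comp φ ψ := ⟨ψ.1 ≫ φ.1, by rw [reassoc_of% ψ.2, φ.2]⟩

lemma comp_val {p : SMor (rud X) S} {a b c : Stage p} (φ : a ⟶ b) (ψ : b ⟶ c) :
    (φ ≫ ψ).1 = ψ.1 ≫ φ.1 := rfl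

variable {p : SMor (rud X) S} {q : SMor (rud Y) T}

/-- Every stage is dominated by all sufficiently late stages of a single index. -/
lemma exists_factor (hp : IsHPolStarExpansion (_root_.Quotient.mk (SMor.setoid _ _) p))
    (a : Stage p) : ∃ (l : S.Idx) (f : ℕ → (S.obj l ⟶ S.obj a.idx)) (n : ℕ), ∀ n' ≥ n,
      (Stage.mk l n' : Stage p).proj ≫ f n' = a.proj :=
  hp.exists_factor (hp.1 a.idx) a.proj

lemma proj_bond (p : SMor (rud X) S) {l k : S.Idx} (h : l ≤ k) :
    ∃ n, ∀ n' ≥ n, (Stage.mk k n' : Stage p).proj ≫ S.bond h = (Stage.mk l n' : Stage p).proj := by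
  obtain ⟨_, _, _, n, e⟩ := p.comm h
  simp only [rud, Category.id_comp] at e
  exact ⟨n, e⟩

/-- The hypothesis concerns one value of `n`, while `p*` detects only eventual equalities. Writing
`a.proj` as `c i` after the stage `i` at `l`, for all large `i`, turns it into an eventual equality
of `c i ≫ f` and `c i ≫ g` after the stages at `l`. -/
lemma exists_hom_eq (hp : IsHPolStarExpansion (_root_.Quotient.mk (SMor.setoid _ _) p))
    {P : HTop.{u}} (hP : P.IsHPol) (a : Stage p) (f g : S.obj a.idx ⟶ P)
    (e : a.proj ≫ f = a.proj ≫ g) :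
    ∃ (b : Stage p) (φ : a ⟶ b), φ.1 ≫ f = φ.1 ≫ g := by
  obtain ⟨l, c, n, hc⟩ := exists_factor hp a
  obtain ⟨k, h, m, hm⟩ := hp.exists_bond_eq hP (fun i => c i ≫ f) (fun i => c i ≫ g) n
    fun i hi => by rw [reassoc_of% hc i hi, reassoc_of% hc i hi, e]
  obtain ⟨m', hm'⟩ := proj_bond p h
  -- Beyond `N` the factorization through `c`, the equality after bonding and the compatibility of
  -- the stages at `l` and `k` all hold.
  let N := max n (max m m')
  refine ⟨⟨k, N⟩, ⟨S.bond h ≫ c N, ?_⟩, ?_⟩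
  · rw [reassoc_of% hm' N (by omega), hc N (by omega)]
  · simpa using hm N (by omega)

lemma isFiltered (hp : IsHPolStarExpansion (_root_.Quotient.mk (SMor.setoid _ _) p)) :
    IsFiltered (Stage p) where
  nonempty := ⟨⟨Classical.arbitrary _, 0⟩⟩
  cocone_objs a b := by
    obtain ⟨l, c, n, hc⟩ := exists_factor hp a
    obtain ⟨l', c', n', hc'⟩ := exists_factor hp b
    obtain ⟨k, h, h'⟩ := exists_ge_ge l l'
    obtain ⟨m, hm⟩ := proj_bond p h
    obtain ⟨m', hm'⟩ := proj_bond p h'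
    let N := max (max n n') (max m m')
    refine ⟨⟨k, N⟩, ⟨S.bond h ≫ c N, ?_⟩, ⟨S.bond h' ≫ c' N, ?_⟩, trivial⟩
    · rw [reassoc_of% hm N (by omega), hc N (by omega)]
    · rw [reassoc_of% hm' N (by omega), hc' N (by omega)]
  cocone_maps a b f g := by
    obtain ⟨c, φ, e⟩ := exists_hom_eq hp (hp.1 _) b f.1 g.1 (f.2.trans g.2.symm)
    exact ⟨c, φ, Subtype.ext e⟩

/-- Every map from `X × Y` to an object of `HPol` factors through a product of stages. -/
lemma exists_prod_factor
    (hpq : IsHPolStarExpansion (_root_.Quotient.mk (SMor.setoid _ _) (p.prod q)))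
    {P : HTop.{u}} (hP : P.IsHPol) (h : HTop.prod X Y ⟶ P) :
    ∃ (a : Stage p) (b : Stage q) (f : HTop.prod (S.obj a.idx) (T.obj b.idx) ⟶ P),
      HTop.prodMap a.proj b.proj ≫ f = h := by
  obtain ⟨l, f, n, e⟩ := hpq.exists_factor hP h
  exact ⟨⟨l.1, n⟩, ⟨l.2, n⟩, f n, e n le_rfl⟩

/-- The stages `a` and `b` may have different steps, whereas `p* × q*` only contains products of
equal step. Factoring each through all late stages of one index restores a common step and also
makes the equality eventual. -/
lemma exists_prod_hom_eq (hp : IsHPolStarExpansion (_root_.Quotient.mk (SMor.setoid _ _) p))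
    (hq : IsHPolStarExpansion (_root_.Quotient.mk (SMor.setoid _ _) q))
    (hpq : IsHPolStarExpansion (_root_.Quotient.mk (SMor.setoid _ _) (p.prod q)))
    {P : HTop.{u}} (hP : P.IsHPol) (a : Stage p) (b : Stage q)
    (f g : HTop.prod (S.obj a.idx) (T.obj b.idx) ⟶ P)
    (e : HTop.prodMap a.proj b.proj ≫ f = HTop.prodMap a.proj b.proj ≫ g) :
    ∃ (a' : Stage p) (φ : a ⟶ a') (b' : Stage q) (ψ : b ⟶ b'),
      HTop.prodMap φ.1 ψ.1 ≫ f = HTop.prodMap φ.1 ψ.1 ≫ g := by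
  obtain ⟨l, c, n, hc⟩ := exists_factor hp a
  obtain ⟨l', c', n', hc'⟩ := exists_factor hq b
  obtain ⟨k, h, m, hm⟩ := hpq.exists_bond_eq hP (l := (l, l'))
    (fun i => HTop.prodMap (c i) (c' i) ≫ f) (fun i => HTop.prodMap (c i) (c' i) ≫ g) (max n n')
    fun i hi => by
      have e₁ : HTop.prodMap (Stage.mk l i : Stage p).proj (Stage.mk l' i : Stage q).proj ≫
          HTop.prodMap (c i) (c' i) = HTop.prodMap a.proj b.proj := by
        rw [HTop.prodMap_comp, hc i (le_of_max_le_left hi), hc' i (le_of_max_le_right hi)]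
      change HTop.prodMap (Stage.mk l i : Stage p).proj (Stage.mk l' i : Stage q).proj ≫
          HTop.prodMap (c i) (c' i) ≫ f =
        HTop.prodMap (Stage.mk l i : Stage p).proj (Stage.mk l' i : Stage q).proj ≫
          HTop.prodMap (c i) (c' i) ≫ g
      rw [reassoc_of% e₁, reassoc_of% e₁, e]
  obtain ⟨m₁, hm₁⟩ := proj_bond p h.1
  obtain ⟨m₂, hm₂⟩ := proj_bond q h.2
  let N := max (max n n') (max m (max m₁ m₂))
  refine ⟨⟨k.1, N⟩, ⟨S.bond h.1 ≫ c N, ?_⟩, ⟨k.2, N⟩, ⟨T.bond h.2 ≫ c' N, ?_⟩, ?_⟩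
  · rw [reassoc_of% hm₁ N (by omega), hc N (by omega)]
  · rw [reassoc_of% hm₂ N (by omega), hc' N (by omega)]
  · rw [← HTop.prodMap_comp, Category.assoc, Category.assoc]
    exact hm N (by omega)

/-! ### `HPol`-expansions from final diagrams of stages -/

variable {α β : Type u} [PartialOrder α] [IsDirectedOrder α] [Nonempty α]
  [PartialOrder β] [IsDirectedOrder β] [Nonempty β]

/-- The inverse system obtained from a directed diagram of stages. -/
def system (F : α ⥤ Stage p) : InvSystem.{u} HTop.{u} where
  Idx := α
  obj i := S.obj (F.obj i).idx
  bond h := (F.map (homOfLE h)).1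
  bond_refl i := congrArg Subtype.val (F.map_id i)
  bond_trans h h' := congrArg Subtype.val (F.map_comp (homOfLE h) (homOfLE h')).symm

/-- A morphism out of a member of a final diagram of stages is dominated by a bonding map. -/
lemma exists_map_eq [IsFiltered (Stage p)] (F : α ⥤ Stage p) [F.Final] {i : α} {b : Stage p}
    (φ : F.obj i ⟶ b) :
    ∃ (k : α) (h : i ≤ k) (ψ : b ⟶ F.obj k), F.map (homOfLE h) = φ ≫ ψ := by
  have := isFiltered_of_directed_le_nonempty α
  obtain ⟨h₁, h₂⟩ := (Functor.final_iff_of_isFiltered F).1 inferInstance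
  obtain ⟨j, ⟨t⟩⟩ := h₁ b
  obtain ⟨k, hi, hj⟩ := exists_ge_ge i j
  -- The bonding arrow and the detour through `b` are parallel arrows into `F.obj k`; finality makes
  -- them equal further up.
  obtain ⟨l, s, e⟩ := h₂ (F.map (homOfLE hi)) (φ ≫ t ≫ F.map (homOfLE hj))
  refine ⟨l, hi.trans (leOfHom s), t ≫ F.map (homOfLE hj) ≫ F.map s, ?_⟩
  rw [Category.assoc, Category.assoc] at e
  rw [← e, ← F.map_comp]
  rfl

lemma exists_hom_map (F : α ⥤ Stage p) [F.Final] (b : Stage p) :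
    ∃ k : α, Nonempty (b ⟶ F.obj k) := by
  have := isFiltered_of_directed_le_nonempty α
  exact (Functor.final_iff_of_isFiltered F).1 inferInstance |>.1 b

/-- A final diagram of stages of an `HPol*`-expansion gives an `HPol`-expansion. -/
lemma isHPolApproximation
    (hp : IsHPolStarExpansion (_root_.Quotient.mk (SMor.setoid _ _) p))
    (F : α ⥤ Stage p) [F.Final] :
    IsHPolApproximation (system F) fun i => (F.obj i).proj where
  inHPol i := hp.1 _
  comm h := (F.map (homOfLE h)).2
  exists_factor hP h := by
    obtain ⟨l, f, n, e⟩ := hp.exists_factor hP h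
    obtain ⟨k, ⟨φ⟩⟩ := exists_hom_map F ⟨l, n⟩
    refine ⟨k, φ.1 ≫ f n, ?_⟩
    change (F.obj k).proj ≫ φ.1 ≫ f n = h
    rw [reassoc_of% φ.2, e n le_rfl]
  exists_bond_eq {_} hP {i} f g e := by
    have := isFiltered hp
    obtain ⟨b, φ, eφ⟩ := exists_hom_eq hp hP (F.obj i) f g e
    obtain ⟨k, h, ψ, hψ⟩ := exists_map_eq F φ
    refine ⟨k, h, ?_⟩
    change (F.map (homOfLE h)).1 ≫ f = (F.map (homOfLE h)).1 ≫ g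
    rw [hψ]
    exact (Category.assoc _ _ _).trans
      ((congrArg (ψ.1 ≫ ·) eφ).trans (Category.assoc _ _ _).symm)

/-- If `p × q` is an `HPol*`-expansion, final diagrams of stages of `p` and of `q` give an
`HPol`-expansion of `X × Y`. -/
lemma isHPolApproximation_prod
    (hp : IsHPolStarExpansion (_root_.Quotient.mk (SMor.setoid _ _) p))
    (hq : IsHPolStarExpansion (_root_.Quotient.mk (SMor.setoid _ _) q))
    (hpq : IsHPolStarExpansion (_root_.Quotient.mk (SMor.setoid _ _) (p.prod q)))
    (F : α ⥤ Stage p) [F.Final] (G : β ⥤ Stage q) [G.Final] :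
    IsHPolApproximation ((system F).prod (system G)) fun i =>
      HTop.prodMap (F.obj i.1).proj (G.obj i.2).proj where
  -- Only the indices of the two stages matter here, so their steps may differ.
  inHPol i := hpq.1 ((F.obj i.1).idx, (G.obj i.2).idx)
  comm {i j} h := by
    refine (HTop.prodMap_comp _ _ _ _).trans ?_
    exact congrArg₂ HTop.prodMap (F.map (homOfLE h.1)).2 (G.map (homOfLE h.2)).2
  exists_factor hP h := by
    obtain ⟨a, b, f, e⟩ := exists_prod_factor hpq hP h
    obtain ⟨k, ⟨φ⟩⟩ := exists_hom_map F a
    obtain ⟨k', ⟨φ'⟩⟩ := exists_hom_map G b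
    refine ⟨(k, k'), HTop.prodMap φ.1 φ'.1 ≫ f, ?_⟩
    have e' := HTop.prodMap_comp (F.obj k).proj φ.1 (G.obj k').proj φ'.1
    rw [φ.2, φ'.2] at e'
    exact (Category.assoc _ _ _).symm.trans ((congrArg (· ≫ f) e').trans e)
  exists_bond_eq {_} hP {i} f g e := by
    have := isFiltered hp
    have := isFiltered hq
    obtain ⟨a, φ, b, φ', eφ⟩ := exists_prod_hom_eq hp hq hpq hP (F.obj i.1) (G.obj i.2) f g e
    obtain ⟨k, h, ψ, hψ⟩ := exists_map_eq F φ
    obtain ⟨k', h', ψ', hψ'⟩ := exists_map_eq G φ'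
    refine ⟨(k, k'), ⟨h, h'⟩, ?_⟩
    change HTop.prodMap (F.map (homOfLE h)).1 (G.map (homOfLE h')).1 ≫ f =
      HTop.prodMap (F.map (homOfLE h)).1 (G.map (homOfLE h')).1 ≫ g
    rw [hψ, hψ', comp_val, comp_val, ← HTop.prodMap_comp]
    exact (Category.assoc _ _ _).trans
      ((congrArg (HTop.prodMap ψ.1 ψ'.1 ≫ ·) eφ).trans (Category.assoc _ _ _).symm)

end Stage

end Stages

/-! ## Products in the coarse shape category -/

/-- If the product of `HPol`-expansions of `X` and `Y` is an `HPol`-expansion of `X × Y`, then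
`X × Y` is a product of `X` and `Y` in the coarse shape category. -/
lemma IsHPolApproximation.isCoarseShapeProduct {X Y : HTop.{u}} {S T : InvSystem.{u} HTop.{u}}
    {r : ∀ i, X ⟶ S.obj i} {s : ∀ j, Y ⟶ T.obj j} (hr : IsHPolApproximation S r)
    (hs : IsHPolApproximation T s)
    (hrs : IsHPolApproximation (S.prod T) fun i => HTop.prodMap (r i.1) (s i.2)) :
    ∃ (πX : CoarseShapeHom (HTop.prod X Y) X) (πY : CoarseShapeHom (HTop.prod X Y) Y),
      πX.IsInducedBy (HTop.fst X Y) ∧ πY.IsInducedBy (HTop.snd X Y) ∧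
        IsCoarseShapeProduct πX πY := by
  refine ⟨.mk hrs.expansion hr.expansion ((proToProStar HTop.{u}).map (Pro.fst S T)),
    .mk hrs.expansion hs.expansion ((proToProStar HTop.{u}).map (Pro.snd S T)),
    ⟨hrs.expansion, hr.expansion, Pro.fst S T, ?_, rfl⟩,
    ⟨hrs.expansion, hs.expansion, Pro.snd S T, ?_, rfl⟩, fun Z F G => ?_⟩
  · exact _root_.Quotient.sound fun i => ⟨PUnit.unit, le_rfl, le_rfl,
      congrArg (𝟙 (HTop.prod X Y) ≫ ·) (HTop.prodMap_fst _ _)⟩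
  · exact _root_.Quotient.sound fun i => ⟨PUnit.unit, le_rfl, le_rfl,
      congrArg (𝟙 (HTop.prod X Y) ≫ ·) (HTop.prodMap_snd _ _)⟩
  -- An arbitrary `Z` need not come with an expansion; a representative of `F` carries one.
  · obtain ⟨z⟩ : Nonempty (HPolExpansion Z) := _root_.Quotient.inductionOn F fun F => ⟨F.source⟩
    obtain ⟨f, rfl, hf⟩ := F.existsUnique_rep z hr.expansion
    obtain ⟨g, rfl, hg⟩ := G.existsUnique_rep z hs.expansion
    obtain ⟨h, ⟨h₁, h₂⟩, hu⟩ := ProStar.existsUnique_lift f g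
    refine ⟨.mk z hrs.expansion h, ⟨?_, ?_⟩, fun H hH => ?_⟩
    · exact (CoarseShapeHom.mk_comp_mk _ _ _ _ _).trans (congrArg _ h₁)
    · exact (CoarseShapeHom.mk_comp_mk _ _ _ _ _).trans (congrArg _ h₂)
    · obtain ⟨k, rfl, -⟩ := H.existsUnique_rep z hrs.expansion
      exact congrArg _ (hu k
        ⟨hf _ ((CoarseShapeHom.mk_comp_mk _ _ _ _ _).symm.trans hH.1),
          hg _ ((CoarseShapeHom.mk_comp_mk _ _ _ _ _).symm.trans hH.2)⟩)

theorem mainTheorem3 (X Y : Type u) [TopologicalSpace X] [TopologicalSpace Y]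
    (S T : InvSystem.{u} HTop.{u})
    (p : (⟨InvSystem.rud (HTop.of X)⟩ : ProStar.{u} HTop.{u}) ⟶ ⟨S⟩)
    (q : (⟨InvSystem.rud (HTop.of Y)⟩ : ProStar.{u} HTop.{u}) ⟶ ⟨T⟩)
    (hp : IsHPolStarExpansion p) (hq : IsHPolStarExpansion q)
    (hpq : IsHPolStarExpansion (ProStar.prodHom p q)) :
    ∃ (πX : CoarseShapeHom (HTop.of (X × Y)) (HTop.of X))
      (πY : CoarseShapeHom (HTop.of (X × Y)) (HTop.of Y)),
      πX.IsInducedBy (HTop.homMk ContinuousMap.fst) ∧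
        πY.IsInducedBy (HTop.homMk ContinuousMap.snd) ∧
        IsCoarseShapeProduct πX πY := by
  induction p using _root_.Quotient.inductionOn with | _ p
  induction q using _root_.Quotient.inductionOn with | _ q
  have := Stage.isFiltered hp
  have := Stage.isFiltered hq
  -- A small filtered category receives a final functor from a directed poset, which replaces stages
  -- and their many arrows by a genuine inverse system.
  obtain ⟨α, _, _, _, F, _⟩ := IsFiltered.exists_directed (Stage p)
  obtain ⟨β, _, _, _, G, _⟩ := IsFiltered.exists_directed (Stage q)
  exact (Stage.isHPolApproximation hp F).isCoarseShapeProduct (Stage.isHPolApproximation hq G)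
    (Stage.isHPolApproximation_prod hp hq hpq F G)
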